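/- Let $\mathbb K=\mathbb R$ or $\mathbb C$, let $X$ and $Y$ be Banach spaces over $\mathbb K$, let $k\ge 1$ be an integer, and let $P\colon X\to Y$ be a continuous $k$-homogeneous polynomial, that is, $P(x)=M(x,\dots,x)$ for some continuous $k$-linear map $M\colon X^k\to Y$. A series $\sum x_n$ in $X$ is *weakly unconditionally Cauchy* (w.u.C.) if $\sum_n|\varphi(x_n)|<\infty$ for every $\varphi\in X^*$, and *unconditionally convergent* (u.c.) if every subseries converges in norm. The polynomial $P$ is *unconditionally converging* if, for each w.u.C. series $\sum x_n$ in $X$, the sequence $\bigl(P(\sum_{i=1}^n x_i)\bigr)_n$ converges in norm in $Y$. It is an *Orlicz-Pettis polynomial* if every w.u.C. series $\sum x_n$ in $X$ with the following property is u.c.: for every bounded sequence $(a_n)\subset c_0$, the set $\{P(\sum_{i=1}^\infty a_n(i)x_i): n\in\mathbb N\}$ is relatively weakly compact in $Y$. A set $A\subset X$ is a *WUC-set* if $A=T(B_{c_0})$ for some bounded linear operator $T\colon c_0\to X$, where $B_{c_0}$ is the closed unit ball of $c_0$ (over $\mathbb K$). Then: (a) The following are equivalent: (a1) $P$ is unconditionally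 converging; (a2) $P(A)$ is relatively compact in $Y$ for every WUC-set $A\subset X$; (a3) $P(A)$ is relatively weakly compact in $Y$ for every WUC-set $A\subset X$. (b) The following are equivalent: (b1) $P$ is an Orlicz-Pettis polynomial; (b2) for every WUC-set $A\subset X$, if $P(A)$ is relatively compact in $Y$, then $A$ is relatively compact in $X$; (b3) for every WUC-set $A\subset X$, if $P(A)$ is relatively weakly compact in $Y$, then $A$ is relatively weakly compact in $X$. -/

import Mathlib

open scoped ZeroAtInfty

namespace OrliczPettis

variable (𝕜 : Type*) [RCLike 𝕜]
variable {X : Type*} [NormedAddCommGroup X] [NormedSpace 𝕜 X]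
variable {Y : Type*} [NormedAddCommGroup Y] [NormedSpace 𝕜 Y]

/-- `P` is a continuous `k`-homogeneous polynomial from `X` into `Y`: it is the restriction to the
diagonal of a continuous `k`-linear map `X × ⋯ × X → Y`. -/
def IsHomogeneousPolynomial (k : ℕ) (P : X → Y) : Prop :=
  ∃ M : ContinuousMultilinearMap 𝕜 (fun _ : Fin k => X) Y, ∀ x : X, P x = M (fun _ => x)

/-- The formal series `∑ xₙ` is weakly unconditionally Cauchy:
`∑ |φ(xₙ)| < ∞` for every continuous linear functional `φ`. -/
def IsWUC (x : ℕ → X) : Prop :=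
  ∀ φ : StrongDual 𝕜 X, Summable (fun n => ‖φ (x n)‖)

/-- The series `∑ xₙ` is unconditionally convergent: every subseries converges
(in norm, as a sequence of partial sums). -/
def IsUC {X : Type*} [NormedAddCommGroup X] (x : ℕ → X) : Prop :=
  ∀ σ : ℕ → ℕ, StrictMono σ →
    ∃ s : X, Filter.Tendsto (fun n => ∑ i ∈ Finset.range n, x (σ i)) Filter.atTop (nhds s)

/-- `A` is relatively compact for the norm topology. -/
def IsRelCompact {X : Type*} [NormedAddCommGroup X] (A : Set X) : Prop :=
  IsCompact (closure A)

/-- `A` is relatively weakly compact: its closure in the weak topology is weakly compact. -/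
def IsRelWeaklyCompact (A : Set X) : Prop :=
  IsCompact (closure (toWeakSpace 𝕜 X '' A))

/-- `P` is unconditionally converging: for each weakly unconditionally Cauchy series `∑ xₙ`,
the sequence `P(x₁ + ⋯ + xₙ)` converges in norm. -/
def IsUnconditionallyConverging (P : X → Y) : Prop :=
  ∀ x : ℕ → X, IsWUC 𝕜 x →
    ∃ y : Y, Filter.Tendsto (fun n => P (∑ i ∈ Finset.range n, x i)) Filter.atTop (nhds y)

/-- `P` has the Orlicz-Pettis property: a weakly unconditionally Cauchy series `∑ xₙ` is
unconditionally convergent as soon as, for every bounded sequence `(aₙ)` in `c₀`, the set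
`{P(∑ᵢ aₙ(i) xᵢ) : n ∈ ℕ}` is relatively weakly compact. Here `C₀(ℕ, 𝕜)` is `c₀` with the sup norm.
In a Banach space the inner series converge (unconditionally), since `∑ xᵢ` is weakly
unconditionally Cauchy and the coefficients tend to zero. -/
def IsOrliczPettis (P : X → Y) : Prop :=
  ∀ x : ℕ → X, IsWUC 𝕜 x →
    (∀ a : ℕ → C₀(ℕ, 𝕜), Bornology.IsBounded (Set.range a) →
      IsRelWeaklyCompact 𝕜 (Set.range fun n => P (∑' i, a n i • x i))) →
    IsUC x

/-- `A` is a WUC-set: the image of the closed unit ball of `c₀` under a bounded linear operator. -/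
def IsWUCSet (A : Set X) : Prop :=
  ∃ T : C₀(ℕ, 𝕜) →L[𝕜] X, A = T '' Metric.closedBall 0 1

end OrliczPettis

/-!
A weakly unconditionally Cauchy series `∑ xᵢ` is the same thing as a bounded operator `T : c₀ → X`
with `T eᵢ = xᵢ`, so everything reduces to homogeneous polynomials on `c₀`. The claim is that for
such a polynomial `g` relative compactness of `g (B)`, relative weak compactness of `g (B)`, and
norm convergence of `g (∑_{i < n} bᵢ eᵢ)` for all bounded `b` are each equivalent to `g` being
weak-to-norm uniformly continuous on bounded sets. For `T` itself, which is `1`-homogeneous, this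
continuity says that `∑ T eᵢ` is unconditionally convergent.

Uniform continuity is proved by induction on the degree: the forward differences of `g` have smaller
degree, and if `g` fails while they succeed, then a gliding hump argument yields blocks `wⱼ` with
uniformly bounded finite sums, `‖g (wⱼ) - g 0‖ ≥ ε`, and `g (w_F + wₙ) - g (w_F) ≈ g (wₙ) - g 0`
for every finite set `F` of indices below `n`.
* For scalar `g` the partial sums of these blocks make `g` drift off to infinity, which is
  impossible because `g` is bounded on balls. Hence `φ ∘ g` is uniformly continuous for every
  functional `φ`.
* For vector-valued `g`, the hypothesis lets `F ↦ g (w_F)` extend to a weakly continuous map on the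
  Cantor space. Its range is norm separable by Mazur's theorem, so by Baire's theorem it has
  arbitrarily small norm oscillation on some open set; but switching a large index on changes it by
  nearly `ε`.
-/

namespace OrliczPettis

open Filter Topology

section Sequences

variable {𝕜 : Type*} [RCLike 𝕜]

theorem c0_norm_le_iff {a : C₀(ℕ, 𝕜)} {R : ℝ} (hR : 0 ≤ R) : ‖a‖ ≤ R ↔ ∀ i, ‖a i‖ ≤ R := by
  rw [← ZeroAtInftyContinuousMap.norm_toBCF_eq_norm, BoundedContinuousFunction.norm_le hR]
  rfl

theorem c0_norm_apply_le (a : C₀(ℕ, 𝕜)) (i : ℕ) : ‖a i‖ ≤ ‖a‖ :=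
  (c0_norm_le_iff (norm_nonneg a)).1 le_rfl i

theorem c0_tendsto_zero (a : C₀(ℕ, 𝕜)) : Tendsto a atTop (𝓝 0) := by
  have := a.zero_at_infty'
  rwa [cocompact_eq_cofinite, Nat.cofinite_eq_atTop] at this

theorem c0_sum_apply {ι : Type*} (s : Finset ι) (w : ι → C₀(ℕ, 𝕜)) (i : ℕ) :
    (∑ j ∈ s, w j) i = ∑ j ∈ s, w j i := by
  classical
  induction s using Finset.induction_on with
  | empty => simp
  | insert j s hj ih => simp [Finset.sum_insert hj, ih]

/-- The element of `c₀` that agrees with the scalar sequence `b` on the finite set `s` and vanishes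
elsewhere. -/
def truncate (s : Finset ℕ) (b : ℕ → 𝕜) : C₀(ℕ, 𝕜) where
  toFun i := if i ∈ s then b i else 0
  continuous_toFun := continuous_of_discreteTopology
  zero_at_infty' := by
    rw [cocompact_eq_cofinite]
    refine tendsto_const_nhds.congr' ?_
    filter_upwards [s.eventually_cofinite_notMem] with i hi
    rw [if_neg hi]

theorem truncate_apply (s : Finset ℕ) (b : ℕ → 𝕜) (i : ℕ) :
    truncate s b i = if i ∈ s then b i else 0 := rfl

theorem norm_truncate_le (s : Finset ℕ) {b : ℕ → 𝕜} {R : ℝ} (hb : ∀ i, ‖b i‖ ≤ R) :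
    ‖truncate s b‖ ≤ R := by
  have hR : 0 ≤ R := (norm_nonneg _).trans (hb 0)
  refine (c0_norm_le_iff hR).2 fun i => ?_
  rw [truncate_apply]
  split_ifs
  · exact hb i
  · simpa only [norm_zero] using hR

theorem truncate_smul (s : Finset ℕ) (c : 𝕜) (b : ℕ → 𝕜) :
    truncate s (c • b) = c • truncate s b := by
  ext i
  simp [truncate_apply]

theorem tendsto_truncate_range_apply (b : ℕ → 𝕜) (i : ℕ) :
    Tendsto (fun n => truncate (Finset.range n) b i) atTop (𝓝 (b i)) := by
  refine tendsto_const_nhds.congr' ?_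
  filter_upwards [eventually_gt_atTop i] with n hn
  rw [truncate_apply, if_pos (Finset.mem_range.2 hn)]

theorem exists_subseq_tendsto_apply {a : ℕ → C₀(ℕ, 𝕜)} {R : ℝ} (ha : ∀ n, ‖a n‖ ≤ R) :
    ∃ c : ℕ → 𝕜, (∀ i, ‖c i‖ ≤ R) ∧
      ∃ φ : ℕ → ℕ, StrictMono φ ∧ ∀ i, Tendsto (fun n => a (φ n) i) atTop (𝓝 (c i)) := by
  have hK : IsCompact (Set.univ.pi fun _ : ℕ => Metric.closedBall (0 : 𝕜) R) :=
    isCompact_univ_pi fun _ => isCompact_closedBall 0 R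
  obtain ⟨c, hc, φ, hφ, hlim⟩ := hK.tendsto_subseq (x := fun n => ⇑(a n)) fun n i _ =>
    mem_closedBall_zero_iff.2 ((c0_norm_apply_le (a n) i).trans (ha n))
  exact ⟨c, fun i => mem_closedBall_zero_iff.1 (hc i trivial), φ, hφ, tendsto_pi_nhds.1 hlim⟩

theorem tendsto_sub_truncate_apply {z : ℕ → C₀(ℕ, 𝕜)} {c : ℕ → 𝕜}
    (hz : Tendsto (fun k => ∑ i ∈ Finset.range k, ‖z k i - c i‖) atTop (𝓝 0)) (i : ℕ) :
    Tendsto (fun k => (z k - truncate (Finset.range k) c) i) atTop (𝓝 0) := by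
  refine squeeze_zero_norm' ?_ hz
  filter_upwards [eventually_gt_atTop i] with k hk
  have hi := Finset.mem_range.2 hk
  rw [ZeroAtInftyContinuousMap.sub_apply, truncate_apply, if_pos hi]
  exact Finset.single_le_sum (f := fun i => ‖z k i - c i‖) (fun _ _ => norm_nonneg _) hi

theorem exists_diagonal_tendsto_zero {E : Type*} [NormedAddCommGroup E] {f : ℕ → ℕ → E}
    (hf : ∀ k, Tendsto (f k) atTop (𝓝 0)) :
    ∃ q : ℕ → ℕ, Tendsto (fun k => f k (q k)) atTop (𝓝 0) := by
  have hsmall (k : ℕ) : ∃ n, ‖f k n‖ < 1 / ((k : ℝ) + 1) := by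
    simpa only [dist_zero_right] using
      (Metric.tendsto_nhds.1 (hf k) _ Nat.one_div_pos_of_nat).exists
  choose q hq using hsmall
  exact ⟨q, squeeze_zero_norm (fun k => (hq k).le) tendsto_one_div_add_atTop_nhds_zero_nat⟩

end Sequences

section CoordUniformContinuous

variable {𝕜 : Type*} [RCLike 𝕜] {Y : Type*} [NormedAddCommGroup Y]

/-- Weak-to-norm uniform continuity on the bounded subsets of `c₀`, stated with sequences. On a
bounded subset of `c₀` the weak topology is the topology of coordinatewise convergence, so weakly
null differences are encoded coordinatewise. -/
def CoordUniformContinuous (g : C₀(ℕ, 𝕜) → Y) : Prop :=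
  ∀ (R : ℝ) (x y : ℕ → C₀(ℕ, 𝕜)), (∀ n, ‖x n‖ ≤ R) → (∀ n, ‖y n‖ ≤ R) →
    (∀ i, Tendsto (fun n => x n i - y n i) atTop (𝓝 0)) →
    Tendsto (fun n => g (x n) - g (y n)) atTop (𝓝 0)

namespace CoordUniformContinuous

variable {g : C₀(ℕ, 𝕜) → Y}

theorem cauchySeq (hg : CoordUniformContinuous g) {a : ℕ → C₀(ℕ, 𝕜)} {R : ℝ}
    (ha : ∀ n, ‖a n‖ ≤ R) {c : ℕ → 𝕜} (hc : ∀ i, Tendsto (fun n => a n i) atTop (𝓝 (c i))) :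
    CauchySeq fun n => g (a n) := by
  rw [Metric.cauchySeq_iff]
  by_contra! hnot
  obtain ⟨ε, hε, h⟩ := hnot
  choose p hp q hq hpq using h
  have hp_lim : Tendsto p atTop atTop := tendsto_atTop_mono hp tendsto_id
  have hq_lim : Tendsto q atTop atTop := tendsto_atTop_mono hq tendsto_id
  have hlim : Tendsto (fun n => g (a (p n)) - g (a (q n))) atTop (𝓝 0) :=
    hg R _ _ (fun n => ha _) (fun n => ha _) fun i => by
      simpa only [sub_self, Function.comp_def] using ((hc i).comp hp_lim).sub ((hc i).comp hq_lim)
  have : ε ≤ ‖(0 : Y)‖ := ge_of_tendsto' hlim.norm fun n => dist_eq_norm (g (a (p n))) _ ▸ hpq n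
  exact this.not_gt (by simpa only [norm_zero] using hε)

theorem comp_add_right (hg : CoordUniformContinuous g) (h : C₀(ℕ, 𝕜)) :
    CoordUniformContinuous fun x => g (x + h) := fun R x y hx hy hxy =>
  hg (R + ‖h‖) _ _ (fun n => (norm_add_le _ _).trans (by gcongr; exact hx n))
    (fun n => (norm_add_le _ _).trans (by gcongr; exact hy n)) fun i => by
      simpa using hxy i

theorem sub {f : C₀(ℕ, 𝕜) → Y} (hf : CoordUniformContinuous f) (hg : CoordUniformContinuous g) :
    CoordUniformContinuous fun x => f x - g x := fun R x y hx hy hxy => by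
  simpa only [sub_sub_sub_comm, sub_self] using (hf R x y hx hy hxy).sub (hg R x y hx hy hxy)

theorem fwdDiff (hg : CoordUniformContinuous g) (h : C₀(ℕ, 𝕜)) :
    CoordUniformContinuous (fwdDiff h g) :=
  (hg.comp_add_right h).sub hg

theorem isRelCompact_image [CompleteSpace Y] (hg : CoordUniformContinuous g) (R : ℝ) :
    IsRelCompact (g '' Metric.closedBall 0 R) := by
  refine IsSeqCompact.isCompact fun y hy => ?_
  have happrox (n : ℕ) : ∃ a : C₀(ℕ, 𝕜), ‖a‖ ≤ R ∧ ‖y n - g a‖ < 1 / ((n : ℝ) + 1) := by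
    obtain ⟨_, ⟨a, ha, rfl⟩, hya⟩ := Metric.mem_closure_iff.1 (hy n) _ Nat.one_div_pos_of_nat
    exact ⟨a, mem_closedBall_zero_iff.1 ha, dist_eq_norm (y n) _ ▸ hya⟩
  choose a ha hya using happrox
  obtain ⟨c, -, φ, hφ, hlim⟩ := exists_subseq_tendsto_apply ha
  obtain ⟨z, hz⟩ := cauchySeq_tendsto_of_complete (hg.cauchySeq (fun n => ha (φ n)) hlim)
  have herr : Tendsto (fun n => y n - g (a n)) atTop (𝓝 0) :=
    squeeze_zero_norm (fun n => (hya n).le) tendsto_one_div_add_atTop_nhds_zero_nat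
  have hyz : Tendsto (y ∘ φ) atTop (𝓝 z) := by
    simpa only [Function.comp_def, sub_add_cancel, zero_add] using
      (herr.comp hφ.tendsto_atTop).add hz
  exact ⟨z, isClosed_closure.mem_of_tendsto hyz (Eventually.of_forall fun n => hy _), φ, hφ, hyz⟩

end CoordUniformContinuous

end CoordUniformContinuous

section Degree

/-- `f` has degree at most `n` in the sense of Fréchet: all its iterated forward differences of
order `n + 1` vanish. -/
def HasDegreeLE {E F : Type*} [AddCommMonoid E] [AddCommGroup F] : ℕ → (E → F) → Prop
  | 0, f => ∀ x y, f x = f y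
  | n + 1, f => ∀ h, HasDegreeLE n (fwdDiff h f)

variable {𝕜 : Type*} [RCLike 𝕜] {Y : Type*} [NormedAddCommGroup Y]

theorem coordUniformContinuous_of_hasDegreeLE {C : Set (C₀(ℕ, 𝕜) → Y)}
    (hC : ∀ g ∈ C, ∀ h, fwdDiff h g ∈ C)
    (step : ∀ g ∈ C, (∀ h, CoordUniformContinuous (fwdDiff h g)) → CoordUniformContinuous g)
    {k : ℕ} {g : C₀(ℕ, 𝕜) → Y} (hk : HasDegreeLE k g) (hg : g ∈ C) :
    CoordUniformContinuous g := by
  induction k generalizing g with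
  | zero =>
    intro R x y _ _ _
    exact tendsto_const_nhds.congr fun n => (sub_eq_zero.2 (hk (x n) (y n))).symm
  | succ k ih => exact step g hg fun h => ih (hk h) (hC g hg h)

theorem coordUniformContinuous_of_tendsto_zero {g : C₀(ℕ, 𝕜) → Y}
    (hΔ : ∀ h, CoordUniformContinuous (fwdDiff h g))
    (h0 : ∀ (R : ℝ) (u : ℕ → C₀(ℕ, 𝕜)), (∀ n, ‖u n‖ ≤ R) →
      (∀ i, Tendsto (fun n => u n i) atTop (𝓝 0)) → Tendsto (fun n => g (u n)) atTop (𝓝 (g 0))) :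
    CoordUniformContinuous g := by
  intro R x y hx hy hxy
  refine tendsto_of_subseq_tendsto fun ns hns => ?_
  obtain ⟨c, hcR, φ, hφ, hxc⟩ := exists_subseq_tendsto_apply fun n => hx (ns n)
  set m : ℕ → ℕ := ns ∘ φ
  have hm : Tendsto m atTop atTop := hns.comp hφ.tendsto_atTop
  have hyc (i : ℕ) : Tendsto (fun n => y (m n) i) atTop (𝓝 (c i)) := by
    simpa [m] using (hxc i).sub ((hxy i).comp hm)
  let t (k : ℕ) : C₀(ℕ, 𝕜) := truncate (Finset.range k) c
  let Δ (k n : ℕ) : Y := fwdDiff (-t k) g (x (m n)) - fwdDiff (-t k) g (y (m n))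
  let d (z : ℕ → C₀(ℕ, 𝕜)) (k n : ℕ) : ℝ := ∑ i ∈ Finset.range k, ‖z (m n) i - c i‖
  have hΔ0 (k : ℕ) : Tendsto (Δ k) atTop (𝓝 0) :=
    hΔ (-t k) R _ _ (fun n => hx (m n)) (fun n => hy (m n)) fun i => (hxy i).comp hm
  have hd0 {z : ℕ → C₀(ℕ, 𝕜)} (hz : ∀ i, Tendsto (fun n => z (m n) i) atTop (𝓝 (c i))) (k : ℕ) :
      Tendsto (d z k) atTop (𝓝 0) := by
    simpa using tendsto_finsetSum (Finset.range k) fun i _ => ((hz i).sub_const (c i)).norm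
  obtain ⟨q, hq⟩ := exists_diagonal_tendsto_zero fun k =>
    (hΔ0 k).prodMk_nhds ((hd0 hxc k).prodMk_nhds (hd0 hyc k))
  have hbase {z : ℕ → C₀(ℕ, 𝕜)} (hzR : ∀ n, ‖z n‖ ≤ R)
      (hz : Tendsto (fun k => d z k (q k)) atTop (𝓝 0)) :
      Tendsto (fun k => g (z (m (q k)) - t k)) atTop (𝓝 (g 0)) :=
    h0 (R + R) _ (fun k => norm_sub_le_of_le (hzR _) (norm_truncate_le _ hcR))
      (tendsto_sub_truncate_apply hz)
  have hsum := ((hbase hx hq.snd_nhds.fst_nhds).sub (hbase hy hq.snd_nhds.snd_nhds)).sub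
    hq.fst_nhds
  simp only [Prod.fst_zero, sub_self] at hsum
  refine ⟨φ ∘ q, hsum.congr fun k => ?_⟩
  simp only [Δ, fwdDiff, ← sub_eq_add_neg, m, Function.comp_apply]
  abel

end Degree

section Polynomial

theorem HasDegreeLE.sum {E F ι : Type*} [AddCommMonoid E] [AddCommGroup F] {k : ℕ}
    {f : ι → E → F} {s : Finset ι} (hf : ∀ i ∈ s, HasDegreeLE k (f i)) :
    HasDegreeLE k (∑ i ∈ s, f i) := by
  induction k generalizing f with
  | zero =>
    intro x y
    simpa only [Finset.sum_apply] using Finset.sum_congr rfl fun i hi => hf i hi x y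
  | succ k ih =>
    intro h
    rw [fwdDiff_finsetSum]
    exact ih fun i hi => hf i hi h

theorem fwdDiff_multilinearMap_piecewise {R ι E F : Type*} [Semiring R] [DecidableEq ι]
    [AddCommMonoid E] [Module R E] [AddCommGroup F] [Module R F]
    (M : MultilinearMap R (fun _ : ι => E) F) (s : Finset ι) (c : ι → E) (h : E) :
    fwdDiff h (fun x => M (s.piecewise (fun _ => x) c)) =
      ∑ t ∈ s.powerset.erase s,
        fun x => M (t.piecewise (fun _ => x) (s.piecewise (fun _ => h) c)) := by
  funext x
  have hadd : s.piecewise ((fun _ => x) + s.piecewise (fun _ => h) c) (s.piecewise (fun _ => h) c) =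
      s.piecewise (fun _ => x + h) c := by
    funext i
    by_cases hi : i ∈ s <;> simp [hi]
  have hexp := M.map_piecewise_add (fun _ => x) (s.piecewise (fun _ => h) c) s
  rw [hadd, ← Finset.add_sum_erase _ _ (Finset.mem_powerset_self s),
    Finset.piecewise_piecewise_of_subset_right subset_rfl] at hexp
  rw [fwdDiff, hexp, add_sub_cancel_left, Finset.sum_apply]

theorem hasDegreeLE_multilinearMap_piecewise {R ι E F : Type*} [Semiring R] [DecidableEq ι]
    [AddCommMonoid E] [Module R E] [AddCommGroup F] [Module R F]
    (M : MultilinearMap R (fun _ : ι => E) F) {n : ℕ} {s : Finset ι} (hs : s.card ≤ n)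
    (c : ι → E) : HasDegreeLE n fun x => M (s.piecewise (fun _ => x) c) := by
  induction n generalizing s c with
  | zero =>
    obtain rfl := Finset.card_eq_zero.1 (Nat.le_zero.1 hs)
    exact fun x y => by simp only [Finset.piecewise_empty]
  | succ n ih =>
    intro h
    rw [fwdDiff_multilinearMap_piecewise]
    refine HasDegreeLE.sum fun t ht => ih ?_ _
    obtain ⟨hts, ht⟩ := Finset.mem_erase.1 ht
    have := Finset.card_lt_card ((Finset.mem_powerset.1 ht).ssubset_of_ne hts)
    omega

variable {𝕜 : Type*} [RCLike 𝕜] {X : Type*} [NormedAddCommGroup X] [NormedSpace 𝕜 X]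
  {Y : Type*} [NormedAddCommGroup Y] [NormedSpace 𝕜 Y] {k : ℕ} {P : X → Y}

theorem isHomogeneousPolynomial_clm (T : X →L[𝕜] Y) : IsHomogeneousPolynomial 𝕜 1 T :=
  ⟨ContinuousMultilinearMap.ofSubsingleton 𝕜 X Y 0 T, fun _ => rfl⟩

namespace IsHomogeneousPolynomial

theorem hasDegreeLE (hP : IsHomogeneousPolynomial 𝕜 k P) : HasDegreeLE k P := by
  obtain ⟨M, hM⟩ := hP
  have := hasDegreeLE_multilinearMap_piecewise M.toMultilinearMap (Finset.card_fin k).le 0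
  simp only [Finset.piecewise_univ] at this
  rwa [funext hM]

theorem exists_norm_le (hP : IsHomogeneousPolynomial 𝕜 k P) (R : ℝ) :
    ∃ B, ∀ x, ‖x‖ ≤ R → ‖P x‖ ≤ B := by
  obtain ⟨M, hM⟩ := hP
  refine ⟨‖M‖ * R ^ k, fun x hx => ?_⟩
  calc ‖P x‖ ≤ ‖M‖ * ∏ _i : Fin k, ‖x‖ := hM x ▸ M.le_opNorm _
    _ = ‖M‖ * ‖x‖ ^ k := by rw [Finset.prod_const, Finset.card_fin]
    _ ≤ ‖M‖ * R ^ k := by gcongr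

theorem map_smul (hP : IsHomogeneousPolynomial 𝕜 k P) (c : 𝕜) (x : X) :
    P (c • x) = c ^ k • P x := by
  obtain ⟨M, hM⟩ := hP
  rw [hM, hM]
  simpa using M.map_smul_univ (fun _ => c) (fun _ => x)

theorem comp_clm {Z : Type*} [NormedAddCommGroup Z] [NormedSpace 𝕜 Z]
    (hP : IsHomogeneousPolynomial 𝕜 k P) (T : Z →L[𝕜] X) :
    IsHomogeneousPolynomial 𝕜 k fun z => P (T z) := by
  obtain ⟨M, hM⟩ := hP
  exact ⟨M.compContinuousLinearMap fun _ => T, fun z => hM (T z)⟩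

theorem clm_comp {Z : Type*} [NormedAddCommGroup Z] [NormedSpace 𝕜 Z]
    (hP : IsHomogeneousPolynomial 𝕜 k P) (T : Y →L[𝕜] Z) :
    IsHomogeneousPolynomial 𝕜 k fun x => T (P x) := by
  obtain ⟨M, hM⟩ := hP
  exact ⟨T.compContinuousMultilinearMap M, fun x => congrArg T (hM x)⟩

end IsHomogeneousPolynomial

end Polynomial

section GlidingHump

theorem exists_strictMono_forall_of_eventually {P : Finset ℕ → ℕ → Prop}
    (hP : ∀ s, ∀ᶠ n in atTop, P s n) :
    ∃ φ : ℕ → ℕ, StrictMono φ ∧ ∀ n, P ((Finset.range n).image φ) (φ n) := by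
  have hex (s : Finset ℕ) : ∃ n, (∀ m ∈ s, m < n) ∧ P s n :=
    (((Finset.eventually_all s).2 fun m _ => eventually_gt_atTop m).and (hP s)).exists
  choose next hlt hnext using hex
  let S (n : ℕ) : Finset ℕ := n.rec ∅ fun _ s => insert (next s) s
  have hS (n : ℕ) : S n = (Finset.range n).image fun i => next (S i) := by
    induction n with
    | zero => rfl
    | succ n ih => rw [Finset.range_add_one, Finset.image_insert, ← ih]
  refine ⟨fun n => next (S n), strictMono_nat_of_lt_succ fun n => ?_, fun n => hS n ▸ hnext _⟩
  exact hlt _ _ (Finset.mem_insert_self (next (S n)) (S n))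

variable {𝕜 : Type*} [RCLike 𝕜] {Y : Type*} [NormedAddCommGroup Y] {g : C₀(ℕ, 𝕜) → Y}
  {R : ℝ} {u : ℕ → C₀(ℕ, 𝕜)}

theorem norm_sum_le_of_forall_apply {ι : Type*} {s : Finset ι} {w : ι → C₀(ℕ, 𝕜)} {B : ℝ}
    (hw : ∀ i, ∑ j ∈ s, ‖w j i‖ ≤ B) : ‖∑ j ∈ s, w j‖ ≤ B := by
  have hB : 0 ≤ B := (Finset.sum_nonneg fun j _ => norm_nonneg (w j 0)).trans (hw 0)
  refine (c0_norm_le_iff hB).2 fun i => ?_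
  rw [c0_sum_apply]
  exact (norm_sum_le _ _).trans (hw i)

theorem eventually_forall_add_norm_lt {G : ℕ → ℝ} {B : ℝ} (hG : Tendsto G atTop (𝓝 0))
    (hGB : ∀ i, G i < B) (hRB : R < B) (hu : ∀ n, ‖u n‖ ≤ R)
    (hu0 : ∀ i, Tendsto (fun n => u n i) atTop (𝓝 0)) :
    ∀ᶠ n in atTop, ∀ i, G i + ‖u n i‖ < B := by
  obtain ⟨N, hN⟩ := eventually_atTop.1 (hG.eventually (gt_mem_nhds (sub_pos.2 hRB)))
  have hhead : ∀ᶠ n in atTop, ∀ i ∈ Finset.range N, ‖u n i‖ < B - G i :=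
    (Finset.eventually_all _).2 fun i _ =>
      (tendsto_zero_iff_norm_tendsto_zero.1 (hu0 i)).eventually
        (gt_mem_nhds (sub_pos.2 (hGB i)))
  filter_upwards [hhead] with n hn i
  rcases lt_or_ge i N with hi | hi
  · linarith [hn i (Finset.mem_range.2 hi)]
  · linarith [hN i hi, c0_norm_apply_le (u n) i, hu n]

theorem exists_gliding_subseq (hΔ : ∀ h, CoordUniformContinuous (fwdDiff h g))
    (hu : ∀ n, ‖u n‖ ≤ R) (hu0 : ∀ i, Tendsto (fun n => u n i) atTop (𝓝 0)) {η : ℝ}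
    (hη : 0 < η) :
    ∃ φ : ℕ → ℕ, StrictMono φ ∧ (∀ F i, ∑ n ∈ F, ‖u (φ n) i‖ ≤ R + 1) ∧
      ∀ n, ∀ F ⊆ Finset.range n,
        ‖fwdDiff (∑ j ∈ F, u (φ j)) g (u (φ n)) - fwdDiff (∑ j ∈ F, u (φ j)) g 0‖ ≤ η := by
  have hR : 0 ≤ R := (norm_nonneg _).trans (hu 0)
  have hroom (s : Finset ℕ) : ∀ᶠ n in atTop, (∀ i, ∑ m ∈ s, ‖u m i‖ < R + 1) →
      ∀ i, ∑ m ∈ s, ‖u m i‖ + ‖u n i‖ < R + 1 := by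
    by_cases hs : ∀ i, ∑ m ∈ s, ‖u m i‖ < R + 1
    · have hG : Tendsto (fun i => ∑ m ∈ s, ‖u m i‖) atTop (𝓝 0) := by
        simpa using tendsto_finsetSum s fun m _ => (c0_tendsto_zero (u m)).norm
      filter_upwards [eventually_forall_add_norm_lt hG hs (lt_add_one R) hu hu0] with n hn _
      exact hn
    · exact Eventually.of_forall fun n h => absurd h hs
  have hsmall (h : C₀(ℕ, 𝕜)) : ∀ᶠ n in atTop, ‖fwdDiff h g (u n) - fwdDiff h g 0‖ ≤ η := by
    have := hΔ h R u 0 hu (fun _ => by simpa using hR) fun i => by simpa using hu0 i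
    filter_upwards [Metric.tendsto_nhds.1 this η hη] with n hn
    exact (dist_zero_right (fwdDiff h g (u n) - fwdDiff h g 0) ▸ hn).le
  obtain ⟨φ, hφ, hall⟩ := exists_strictMono_forall_of_eventually fun s =>
    (hroom s).and ((Finset.eventually_all s.powerset).2 fun F _ => hsmall (∑ m ∈ F, u m))
  have hrange (N : ℕ) : ∀ i, ∑ n ∈ Finset.range N, ‖u (φ n) i‖ < R + 1 := by
    induction N with
    | zero => exact fun _ => by simpa using by linarith
    | succ N ih =>
      simpa [Finset.sum_range_succ, Finset.sum_image hφ.injective.injOn, ih] using (hall N).1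
  refine ⟨φ, hφ, fun F i => ?_, fun n F hF => ?_⟩
  · obtain ⟨N, hN⟩ := F.exists_nat_subset_range
    exact (Finset.sum_le_sum_of_subset_of_nonneg hN fun _ _ _ => norm_nonneg _).trans
      (hrange N i).le
  · simpa [Finset.sum_image hφ.injective.injOn] using
      (hall n).2 (F.image φ) (Finset.mem_powerset.2 (Finset.image_subset_image hF))

theorem exists_null_seq_of_not_coordUniformContinuous
    (hΔ : ∀ h, CoordUniformContinuous (fwdDiff h g)) (hg : ¬ CoordUniformContinuous g) :
    ∃ ε > 0, ∃ (R : ℝ) (u : ℕ → C₀(ℕ, 𝕜)), (∀ n, ‖u n‖ ≤ R) ∧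
      (∀ i, Tendsto (fun n => u n i) atTop (𝓝 0)) ∧ ∀ n, ε ≤ ‖g (u n) - g 0‖ := by
  contrapose! hg
  refine coordUniformContinuous_of_tendsto_zero hΔ fun R u hu hu0 => ?_
  rw [Metric.tendsto_nhds]
  by_contra! hnot
  obtain ⟨ε, hε, hfreq⟩ := hnot
  obtain ⟨φ, hφ, hεφ⟩ := extraction_of_frequently_atTop hfreq
  obtain ⟨n, hn⟩ := hg ε hε R (u ∘ φ) (fun n => hu _) fun i => (hu0 i).comp hφ.tendsto_atTop
  exact hn.not_ge (dist_eq_norm (g (u (φ n))) _ ▸ hεφ n)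

theorem eq_zero_of_norm_increment_sub_le {E : Type*} [NormedAddCommGroup E] [NormedSpace ℝ E]
    {v : ℕ → E} {L : E} (hv : ∀ n, ‖v (n + 1) - v n - L‖ ≤ ‖L‖ / 2) {B : ℝ}
    (hB : ∀ n, ‖v n‖ ≤ B) : L = 0 := by
  have hdrift (n : ℕ) : ‖v n - v 0 - (n : ℝ) • L‖ ≤ n * (‖L‖ / 2) := by
    induction n with
    | zero => simp
    | succ n ih =>
      have hsplit : v (n + 1) - v 0 - ((n + 1 : ℕ) : ℝ) • L =
          (v n - v 0 - (n : ℝ) • L) + (v (n + 1) - v n - L) := by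
        push_cast
        module
      rw [hsplit, Nat.cast_succ, add_one_mul]
      exact norm_add_le_of_le ih (hv n)
  by_contra hL
  obtain ⟨n, hn⟩ := exists_nat_gt ((B + B) / (‖L‖ / 2))
  have hlarge : B + B < n * (‖L‖ / 2) := (div_lt_iff₀ (half_pos (norm_pos_iff.2 hL))).1 hn
  have hle : n * ‖L‖ ≤ (B + B) + n * (‖L‖ / 2) := calc
    n * ‖L‖ = ‖(n : ℝ) • L‖ := by rw [norm_smul, Real.norm_natCast]
    _ ≤ ‖v n - v 0‖ + ‖v n - v 0 - (n : ℝ) • L‖ := norm_le_norm_add_norm_sub _ _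
    _ ≤ (B + B) + n * (‖L‖ / 2) := add_le_add (norm_sub_le_of_le (hB n) (hB 0)) (hdrift n)
  linarith

theorem coordUniformContinuous_of_forall_fwdDiff_of_bounded [NormedSpace ℝ Y] [ProperSpace Y]
    (hb : ∀ R : ℝ, ∃ M, ∀ x, ‖x‖ ≤ R → ‖g x‖ ≤ M)
    (hΔ : ∀ h, CoordUniformContinuous (fwdDiff h g)) : CoordUniformContinuous g := by
  by_contra hg
  obtain ⟨ε, hε, R, u, hu, hu0, hεu⟩ := exists_null_seq_of_not_coordUniformContinuous hΔ hg
  obtain ⟨M, hM⟩ := hb R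
  obtain ⟨L, -, θ, hθ, hL⟩ := tendsto_subseq_of_bounded
    (Metric.isBounded_closedBall (x := (0 : Y)) (r := M + ‖g 0‖)) (x := fun n => g (u n) - g 0)
    fun n => mem_closedBall_zero_iff.2 (norm_sub_le_of_le (hM _ (hu n)) le_rfl)
  have hLpos : 0 < ‖L‖ := hε.trans_le (ge_of_tendsto' hL.norm fun n => hεu _)
  obtain ⟨N, hN⟩ := Metric.tendsto_atTop.1 hL (‖L‖ / 4) (by linarith)
  obtain ⟨φ, -, hwB, hφ⟩ := exists_gliding_subseq (u := fun n => u (θ (n + N))) hΔ (fun n => hu _)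
    (fun i => (hu0 i).comp (hθ.tendsto_atTop.comp (tendsto_add_atTop_nat N)))
    (show 0 < ‖L‖ / 4 by linarith)
  set w : ℕ → C₀(ℕ, 𝕜) := fun n => u (θ (φ n + N))
  have hincr (n : ℕ) :
      ‖g (∑ j ∈ Finset.range (n + 1), w j) - g (∑ j ∈ Finset.range n, w j) - L‖ ≤ ‖L‖ / 2 := by
    have hglide := hφ n _ subset_rfl
    have hlim : ‖g (w n) - g 0 - L‖ ≤ ‖L‖ / 4 :=
      (dist_eq_norm (g (w n) - g 0) L ▸ hN (φ n + N) (Nat.le_add_left _ _)).le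
    rw [Finset.sum_range_succ_comm]
    simp only [fwdDiff, zero_add] at hglide
    calc _ = _ := congrArg norm (by abel)
      _ ≤ ‖L‖ / 4 + ‖L‖ / 4 := norm_add_le_of_le hglide hlim
      _ = ‖L‖ / 2 := by ring
  obtain ⟨B, hB⟩ := hb (R + 1)
  exact hLpos.ne' (norm_eq_zero.2 (eq_zero_of_norm_increment_sub_le hincr fun n =>
    hB _ (norm_sum_le_of_forall_apply (hwB (Finset.range n)))))

end GlidingHump

section Oscillation

variable {𝕜 : Type*} [RCLike 𝕜] {Y : Type*} [NormedAddCommGroup Y] [NormedSpace 𝕜 Y]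

theorem isClosed_toWeakSpace_image {s : Set Y} [NormedSpace ℝ Y] [IsScalarTower ℝ 𝕜 Y]
    (hs : Convex ℝ s) (hc : IsClosed s) : IsClosed (toWeakSpace 𝕜 Y '' s) := by
  rw [← closure_eq_iff_isClosed, ← hs.toWeakSpace_closure 𝕜, hc.closure_eq]

theorem exists_open_norm_sub_le {K : Type*} [TopologicalSpace K] [BaireSpace K] [Nonempty K]
    [TopologicalSpace.SeparableSpace K] {F : K → Y}
    (hF : ∀ φ : StrongDual 𝕜 Y, Continuous fun x => φ (F x)) {ε : ℝ} (hε : 0 < ε) :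
    ∃ U : Set K, IsOpen U ∧ U.Nonempty ∧ ∀ x ∈ U, ∀ y ∈ U, ‖F x - F y‖ ≤ ε := by
  let _ := NormedSpace.restrictScalars ℝ 𝕜 Y
  have hFw : Continuous fun x => toWeakSpace 𝕜 Y (F x) :=
    WeakBilin.continuous_of_continuous_eval _ hF
  have hclosed {s : Set Y} (hs : Convex ℝ s) (hc : IsClosed s) : IsClosed (F ⁻¹' s) := by
    have := (isClosed_toWeakSpace_image (𝕜 := 𝕜) hs hc).preimage hFw
    rwa [← Function.comp_def (toWeakSpace 𝕜 Y) F, Set.preimage_comp,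
      Set.preimage_image_eq _ (toWeakSpace 𝕜 Y).injective] at this
  let S : Submodule 𝕜 Y :=
    (Submodule.span 𝕜 (Set.range (F ∘ TopologicalSpace.denseSeq K))).topologicalClosure
  have hFS : F ⁻¹' S = Set.univ := by
    have hS : IsClosed (F ⁻¹' S) :=
      hclosed (S.restrictScalars ℝ).convex (Submodule.isClosed_topologicalClosure _)
    rw [← hS.closure_eq]
    refine ((TopologicalSpace.denseRange_denseSeq K).mono ?_).closure_eq
    rintro _ ⟨n, rfl⟩
    exact Submodule.le_topologicalClosure _ (Submodule.subset_span ⟨n, rfl⟩)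
  obtain ⟨c, hc, hcS⟩ : TopologicalSpace.IsSeparable (S : Set Y) :=
    (Set.countable_range _).isSeparable.span.closure
  have := hc.to_subtype
  obtain ⟨y, hint⟩ := nonempty_interior_of_iUnion_of_closed
    (f := fun y : c => F ⁻¹' Metric.closedBall y.1 (ε / 2))
    (fun y => hclosed (convex_closedBall _ _) Metric.isClosed_closedBall)
    (Set.eq_univ_of_forall fun x => by
      obtain ⟨y, hy, hxy⟩ := Metric.mem_closure_iff.1 (hcS (hFS.ge trivial)) (ε / 2) (half_pos hε)
      exact Set.mem_iUnion.2 ⟨⟨y, hy⟩, hxy.le⟩)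
  refine ⟨_, isOpen_interior, hint, fun x hx x' hx' => ?_⟩
  have hball {x : K} (hx : x ∈ interior (F ⁻¹' Metric.closedBall y.1 (ε / 2))) :
      dist (F x) y ≤ ε / 2 := interior_subset (s := F ⁻¹' Metric.closedBall y.1 (ε / 2)) hx
  calc ‖F x - F x'‖ = dist (F x) (F x') := (dist_eq_norm _ _).symm
    _ ≤ dist (F x) y + dist (F x') y := dist_triangle_right _ _ _
    _ ≤ ε / 2 + ε / 2 := add_le_add (hball hx) (hball hx')
    _ = ε := add_halves ε

end Oscillation

section WeakConvergence

variable {𝕜 : Type*} [RCLike 𝕜] {Y : Type*} [NormedAddCommGroup Y] [NormedSpace 𝕜 Y]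

variable (𝕜) in
/-- The sequence `y` converges weakly, tested against continuous linear functionals. -/
def WeaklyConvergent (y : ℕ → Y) : Prop :=
  ∃ z, ∀ φ : StrongDual 𝕜 Y, Tendsto (fun n => φ (y n)) atTop (𝓝 (φ z))

namespace WeaklyConvergent

variable {x y : ℕ → Y}

theorem sub (hx : WeaklyConvergent 𝕜 x) (hy : WeaklyConvergent 𝕜 y) :
    WeaklyConvergent 𝕜 fun n => x n - y n := by
  obtain ⟨z, hz⟩ := hx
  obtain ⟨t, ht⟩ := hy
  exact ⟨z - t, fun φ => by simpa only [map_sub] using (hz φ).sub (ht φ)⟩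

theorem const_smul (hx : WeaklyConvergent 𝕜 x) (c : 𝕜) : WeaklyConvergent 𝕜 fun n => c • x n := by
  obtain ⟨z, hz⟩ := hx
  exact ⟨c • z, fun φ => by simpa only [map_smul] using (hz φ).const_smul c⟩

theorem of_tendsto_sub (hx : WeaklyConvergent 𝕜 x)
    (h : ∀ φ : StrongDual 𝕜 Y, Tendsto (fun n => φ (y n) - φ (x n)) atTop (𝓝 0)) :
    WeaklyConvergent 𝕜 y := by
  obtain ⟨z, hz⟩ := hx
  exact ⟨z, fun φ => by simpa using (h φ).add (hz φ)⟩

end WeaklyConvergent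

theorem IsRelWeaklyCompact.weaklyConvergent {y : ℕ → Y}
    (hy : IsRelWeaklyCompact 𝕜 (Set.range y))
    (hc : ∀ φ : StrongDual 𝕜 Y, CauchySeq fun n => φ (y n)) : WeaklyConvergent 𝕜 y := by
  obtain ⟨z, -, hz⟩ := IsCompact.exists_mapClusterPt hy
    (u := fun n => toWeakSpace 𝕜 Y (y n)) (f := atTop) (le_principal_iff.2 (mem_map.2
      (Eventually.of_forall fun n => subset_closure ⟨y n, Set.mem_range_self n, rfl⟩)))
  refine ⟨(toWeakSpace 𝕜 Y).symm z, fun φ => le_nhds_of_cauchy_adhp (hc φ) ?_⟩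
  have hφ : Continuous fun z : WeakSpace 𝕜 Y => φ ((toWeakSpace 𝕜 Y).symm z) :=
    WeakBilin.eval_continuous (topDualPairing 𝕜 Y).flip φ
  exact MapClusterPt.continuousAt_comp (X := WeakSpace 𝕜 Y) hφ.continuousAt hz

theorem IsRelCompact.isRelWeaklyCompact {A : Set Y} (hA : IsRelCompact A) :
    IsRelWeaklyCompact 𝕜 A :=
  (IsCompact.image hA (toWeakSpaceCLM 𝕜 Y).continuous).closure_of_subset
    (Set.image_mono subset_closure)

theorem IsRelWeaklyCompact.mono {A B : Set Y} (hA : IsRelWeaklyCompact 𝕜 A) (h : B ⊆ A) :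
    IsRelWeaklyCompact 𝕜 B :=
  IsCompact.of_isClosed_subset hA isClosed_closure (closure_mono (Set.image_mono h))

end WeakConvergence

section Cantor

/-- The finite set of the indices below `n` that are selected by `χ`. -/
def cantorPrefix (χ : ℕ → Bool) (n : ℕ) : Finset ℕ := {j ∈ Finset.range n | χ j}

/-- A finite set of indices as a point of the Cantor space. -/
def cantorPoint (s : Finset ℕ) : ℕ → Bool := fun j => decide (j ∈ s)

theorem tendsto_cantorPoint_iff {ι : Type*} {l : Filter ι} {s : ι → Finset ℕ} {χ : ℕ → Bool} :
    Tendsto (fun k => cantorPoint (s k)) l (𝓝 χ) ↔ ∀ j, ∀ᶠ k in l, (j ∈ s k ↔ χ j) := by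
  simp only [tendsto_pi_nhds, nhds_discrete, tendsto_pure, cantorPoint]
  simp only [← decide_eq_decide, Bool.decide_eq_true]

theorem tendsto_cantorPoint_cantorPrefix {ι : Type*} {l : Filter ι} {χ : ι → ℕ → Bool}
    {χ₀ : ℕ → Bool} (hχ : Tendsto χ l (𝓝 χ₀)) {m : ι → ℕ} (hm : Tendsto m l atTop) :
    Tendsto (fun k => cantorPoint (cantorPrefix (χ k) (m k))) l (𝓝 χ₀) := by
  refine tendsto_cantorPoint_iff.2 fun j => ?_
  have hj : ∀ᶠ k in l, χ k j = χ₀ j := by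
    simpa only [nhds_discrete, tendsto_pure] using tendsto_pi_nhds.1 hχ j
  filter_upwards [hj, hm.eventually_gt_atTop j] with k hk hjm
  simp [cantorPrefix, hk, hjm]

theorem tendsto_sum_of_tendsto_cantorPoint {E : Type*} [NormedAddCommGroup E] [CompleteSpace E]
    {r : ℕ → E} (hr : Summable fun j => ‖r j‖) {ι : Type*} {l : Filter ι} {s : ι → Finset ℕ}
    {χ : ℕ → Bool} (hs : Tendsto (fun k => cantorPoint (s k)) l (𝓝 χ)) :
    Tendsto (fun k => ∑ j ∈ s k, r j) l (𝓝 (∑' j, if χ j then r j else 0)) := by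
  have hsum (s : Finset ℕ) : ∑ j ∈ s, r j = ∑' j, if j ∈ s then r j else 0 := by
    rw [tsum_eq_sum (s := s) fun j hj => if_neg hj]
    exact Finset.sum_congr rfl fun j hj => (if_pos hj).symm
  simp only [hsum]
  refine tendsto_tsum_of_dominated_convergence hr (fun j => ?_) (Eventually.of_forall fun k j => ?_)
  · refine tendsto_const_nhds.congr' ?_
    filter_upwards [tendsto_cantorPoint_iff.1 hs j] with k hk
    simp only [hk]
  · split_ifs
    · exact le_rfl
    · simp

end Cantor

section WeaklyExtendable

variable {𝕜 : Type*} [RCLike 𝕜] {Y : Type*} [NormedAddCommGroup Y] [NormedSpace 𝕜 Y]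

/-- The map `g` extends from `c₀` to `ℓ^∞` so as to be coordinatewise-to-weakly continuous on
bounded sets. The extension is encoded by weak convergence of `g` along bounded coordinatewise
convergent sequences in `c₀`. -/
structure WeaklyExtendable (g : C₀(ℕ, 𝕜) → Y) : Prop where
  dual_comp (φ : StrongDual 𝕜 Y) : CoordUniformContinuous fun x => φ (g x)
  weaklyConvergent {R : ℝ} {a : ℕ → C₀(ℕ, 𝕜)} (ha : ∀ n, ‖a n‖ ≤ R) {c : ℕ → 𝕜}
    (hc : ∀ i, Tendsto (fun n => a n i) atTop (𝓝 (c i))) : WeaklyConvergent 𝕜 fun n => g (a n)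

namespace WeaklyExtendable

variable {g : C₀(ℕ, 𝕜) → Y}

theorem fwdDiff (hg : WeaklyExtendable g) (h : C₀(ℕ, 𝕜)) : WeaklyExtendable (fwdDiff h g) where
  dual_comp φ := by
    have := (hg.dual_comp φ).fwdDiff h
    unfold _root_.fwdDiff at this ⊢
    simpa only [map_sub] using this
  weaklyConvergent {R a} ha {c} hc :=
    (hg.weaklyConvergent (R := R + ‖h‖) (a := fun n => a n + h) (c := fun i => c i + h i)
      (fun n => norm_add_le_of_le (ha n) le_rfl) fun i => (hc i).add_const (h i)).sub
      (hg.weaklyConvergent ha hc)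

variable {w : ℕ → C₀(ℕ, 𝕜)} {B : ℝ}

theorem exists_limit_sum (hg : WeaklyExtendable g) (hw : ∀ s i, ∑ j ∈ s, ‖w j i‖ ≤ B)
    (χ : ℕ → Bool) :
    ∃ z, ∀ (s : ℕ → Finset ℕ), Tendsto (fun k => cantorPoint (s k)) atTop (𝓝 χ) →
      ∀ φ : StrongDual 𝕜 Y, Tendsto (fun k => φ (g (∑ j ∈ s k, w j))) atTop (𝓝 (φ z)) := by
  have hcoord {s : ℕ → Finset ℕ} (hs : Tendsto (fun k => cantorPoint (s k)) atTop (𝓝 χ)) (i : ℕ) :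
      Tendsto (fun k => (∑ j ∈ s k, w j) i) atTop (𝓝 (∑' j, if χ j then w j i else 0)) := by
    simpa only [c0_sum_apply] using tendsto_sum_of_tendsto_cantorPoint
      (summable_of_sum_le (fun _ => norm_nonneg _) fun s => hw s i) hs
  have hbound (s : Finset ℕ) : ‖∑ j ∈ s, w j‖ ≤ B := norm_sum_le_of_forall_apply (hw s)
  have hχ := tendsto_cantorPoint_cantorPrefix (tendsto_const_nhds (x := χ)) tendsto_id
  obtain ⟨z, hz⟩ := hg.weaklyConvergent (fun _ => hbound _) (hcoord hχ)
  refine ⟨z, fun s hs φ => ?_⟩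
  have hsub := hg.dual_comp φ B _ _ (fun _ => hbound _) (fun _ => hbound _) fun i => by
    simpa only [sub_self] using (hcoord hs i).sub (hcoord hχ i)
  simpa using hsub.add (hz φ)

theorem exists_cantor_extension (hg : WeaklyExtendable g) (hw : ∀ s i, ∑ j ∈ s, ‖w j i‖ ≤ B) :
    ∃ F : (ℕ → Bool) → Y, (∀ φ : StrongDual 𝕜 Y, Continuous fun χ => φ (F χ)) ∧
      ∀ s, F (cantorPoint s) = g (∑ j ∈ s, w j) := by
  choose F hF using hg.exists_limit_sum hw
  have hpoint (s : Finset ℕ) : F (cantorPoint s) = g (∑ j ∈ s, w j) :=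
    (SeparatingDual.eq_iff_forall_dual_eq (R := 𝕜)).2 fun φ =>
      tendsto_nhds_unique (hF _ (fun _ => s) tendsto_const_nhds φ) tendsto_const_nhds
  refine ⟨F, fun φ => continuous_iff_seqContinuous.2 fun χ χ₀ hχ => ?_, hpoint⟩
  have happrox (k : ℕ) : ∃ m ≥ k,
      ‖φ (F (χ k)) - φ (g (∑ j ∈ cantorPrefix (χ k) m, w j))‖ < 1 / ((k : ℝ) + 1) := by
    have hlim := hF (χ k) _ (tendsto_cantorPoint_cantorPrefix tendsto_const_nhds tendsto_id) φ
    have hclose := Metric.tendsto_nhds.1 hlim _ (Nat.one_div_pos_of_nat (n := k))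
    obtain ⟨m, hm, hkm⟩ := (hclose.and (eventually_ge_atTop k)).exists
    exact ⟨m, hkm, by rwa [dist_comm, dist_eq_norm] at hm⟩
  choose m hm hφm using happrox
  have hlim := hF χ₀ _ (tendsto_cantorPoint_cantorPrefix hχ (tendsto_atTop_mono hm tendsto_id)) φ
  have herr := squeeze_zero_norm (fun k => (hφm k).le) tendsto_one_div_add_atTop_nhds_zero_nat
  simpa [Function.comp_def] using herr.add hlim

theorem coordUniformContinuous_of_fwdDiff (hg : WeaklyExtendable g)
    (hΔ : ∀ h, CoordUniformContinuous (_root_.fwdDiff h g)) : CoordUniformContinuous g := by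
  by_contra hcuc
  obtain ⟨ε, hε, R, u, hu, hu0, hεu⟩ := exists_null_seq_of_not_coordUniformContinuous hΔ hcuc
  obtain ⟨ψ, -, hwB, hψ⟩ := exists_gliding_subseq hΔ hu hu0 (half_pos hε)
  obtain ⟨F, hF, hFs⟩ := hg.exists_cantor_extension hwB
  obtain ⟨U, hU, ⟨χ, hχ⟩, hosc⟩ := exists_open_norm_sub_le hF (show 0 < ε / 4 by linarith)
  have hbelow : Tendsto (fun n => cantorPoint (cantorPrefix χ n)) atTop (𝓝 χ) :=
    tendsto_cantorPoint_cantorPrefix tendsto_const_nhds tendsto_id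
  have hinsert : Tendsto (fun n => cantorPoint (insert n (cantorPrefix χ n))) atTop (𝓝 χ) := by
    refine tendsto_cantorPoint_iff.2 fun j => ?_
    filter_upwards [tendsto_cantorPoint_iff.1 hbelow j, eventually_ne_atTop j] with n hn hnj
    simpa [hnj.symm] using hn
  have hUχ := hU.mem_nhds hχ
  obtain ⟨n, hn, hn'⟩ := ((hbelow.eventually_mem hUχ).and (hinsert.eventually_mem hUχ)).exists
  set s := cantorPrefix χ n
  have hns : n ∉ s := by simp [s, cantorPrefix]
  have hsmall := hosc _ hn' _ hn
  rw [hFs, hFs, Finset.sum_insert hns] at hsmall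
  have hglide := hψ n s (Finset.filter_subset _ _)
  simp only [_root_.fwdDiff, zero_add, sub_sub_sub_comm _ (g (u (ψ n)))] at hglide
  have htri := norm_sub_norm_le (g (u (ψ n)) - g 0)
    (g (u (ψ n) + ∑ j ∈ s, u (ψ j)) - g (∑ j ∈ s, u (ψ j)))
  rw [norm_sub_rev (g (u (ψ n)) - g 0)] at htri
  linarith [hεu (ψ n)]

theorem coordUniformContinuous {k : ℕ} (hk : HasDegreeLE k g) (hg : WeaklyExtendable g) :
    CoordUniformContinuous g :=
  coordUniformContinuous_of_hasDegreeLE (C := {g | WeaklyExtendable g}) (fun _ hg => hg.fwdDiff)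
    (fun _ hg => hg.coordUniformContinuous_of_fwdDiff) hk hg

end WeaklyExtendable

end WeaklyExtendable

section HomogeneousOnC0

variable {𝕜 : Type*} [RCLike 𝕜] {Y : Type*} [NormedAddCommGroup Y] [NormedSpace 𝕜 Y] {k : ℕ}

namespace IsHomogeneousPolynomial

theorem coordUniformContinuous_scalar {g : C₀(ℕ, 𝕜) → 𝕜} (hg : IsHomogeneousPolynomial 𝕜 k g) :
    CoordUniformContinuous g := by
  refine coordUniformContinuous_of_hasDegreeLE
    (C := {f | ∀ R : ℝ, ∃ M, ∀ x, ‖x‖ ≤ R → ‖f x‖ ≤ M}) (fun f hf h R => ?_)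
    (fun f => coordUniformContinuous_of_forall_fwdDiff_of_bounded) hg.hasDegreeLE hg.exists_norm_le
  obtain ⟨M, hM⟩ := hf (R + ‖h‖)
  obtain ⟨N, hN⟩ := hf R
  exact ⟨M + N, fun x hx =>
    norm_sub_le_of_le (hM _ (norm_add_le_of_le hx le_rfl)) (hN x hx)⟩

variable {g : C₀(ℕ, 𝕜) → Y}

theorem coordUniformContinuous_of_truncate (hg : IsHomogeneousPolynomial 𝕜 k g)
    (h : ∀ (R : ℝ) (b : ℕ → 𝕜), (∀ i, ‖b i‖ ≤ R) →
      WeaklyConvergent 𝕜 fun n => g (truncate (Finset.range n) b)) : CoordUniformContinuous g := by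
  have hφ (φ : StrongDual 𝕜 Y) : CoordUniformContinuous fun x => φ (g x) :=
    (hg.clm_comp φ).coordUniformContinuous_scalar
  refine WeaklyExtendable.coordUniformContinuous hg.hasDegreeLE ⟨hφ, fun {R a} ha {c} hc => ?_⟩
  have hcR (i : ℕ) : ‖c i‖ ≤ R :=
    le_of_tendsto' (hc i).norm fun n => (c0_norm_apply_le (a n) i).trans (ha n)
  refine (h R c hcR).of_tendsto_sub fun φ =>
    hφ φ R _ _ ha (fun n => norm_truncate_le _ hcR) fun i => ?_
  simpa only [sub_self] using (hc i).sub (tendsto_truncate_range_apply c i)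

theorem coordUniformContinuous_of_isRelWeaklyCompact_range (hg : IsHomogeneousPolynomial 𝕜 k g)
    (h : ∀ a : ℕ → C₀(ℕ, 𝕜), (∀ n, ‖a n‖ ≤ 1) →
      IsRelWeaklyCompact 𝕜 (Set.range fun n => g (a n))) : CoordUniformContinuous g := by
  have hunit {b : ℕ → 𝕜} (hb : ∀ i, ‖b i‖ ≤ 1) :
      WeaklyConvergent 𝕜 fun n => g (truncate (Finset.range n) b) :=
    (h _ fun n => norm_truncate_le _ hb).weaklyConvergent fun φ =>
      (hg.clm_comp φ).coordUniformContinuous_scalar.cauchySeq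
        (fun n => norm_truncate_le _ hb) (tendsto_truncate_range_apply b)
  refine hg.coordUniformContinuous_of_truncate fun R b hb => ?_
  have hR : 0 < R + 1 := by linarith [(norm_nonneg _).trans (hb 0)]
  have hr : ((R + 1 : ℝ) : 𝕜) ≠ 0 := RCLike.ofReal_ne_zero.2 hR.ne'
  have hscaled (i : ℕ) : ‖(((R + 1 : ℝ) : 𝕜)⁻¹ • b) i‖ ≤ 1 := by
    rw [Pi.smul_apply, norm_smul, norm_inv, RCLike.norm_ofReal, abs_of_pos hR,
      inv_mul_le_one₀ hR]
    linarith [hb i]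
  have hpow := (hunit hscaled).const_smul (((R + 1 : ℝ) : 𝕜) ^ k)
  simpa only [truncate_smul, hg.map_smul, smul_smul, ← mul_pow, mul_inv_cancel₀ hr, one_pow,
    one_smul] using hpow

theorem isRelWeaklyCompact_image_iff [CompleteSpace Y] (hg : IsHomogeneousPolynomial 𝕜 k g) :
    IsRelWeaklyCompact 𝕜 (g '' Metric.closedBall 0 1) ↔ CoordUniformContinuous g := by
  refine ⟨fun h => hg.coordUniformContinuous_of_isRelWeaklyCompact_range fun a ha => h.mono ?_,
    fun h => (h.isRelCompact_image 1).isRelWeaklyCompact⟩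
  rintro _ ⟨n, rfl⟩
  exact ⟨a n, mem_closedBall_zero_iff.2 (ha n), rfl⟩

theorem isRelCompact_image_iff [CompleteSpace Y] (hg : IsHomogeneousPolynomial 𝕜 k g) :
    IsRelCompact (g '' Metric.closedBall 0 1) ↔ CoordUniformContinuous g :=
  ⟨fun h => hg.isRelWeaklyCompact_image_iff.1 h.isRelWeaklyCompact, fun h => h.isRelCompact_image 1⟩

end IsHomogeneousPolynomial

end HomogeneousOnC0

section UnitVectors

variable (𝕜 : Type*) [RCLike 𝕜]

/-- The unit vectors of `c₀`. -/
def unitVec (i : ℕ) : C₀(ℕ, 𝕜) :=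
  truncate {i} 1

variable {𝕜} {X : Type*} [NormedAddCommGroup X] [NormedSpace 𝕜 X]

theorem truncate_eq_sum (s : Finset ℕ) (b : ℕ → 𝕜) :
    truncate s b = ∑ i ∈ s, b i • unitVec 𝕜 i := by
  ext j
  simp [c0_sum_apply, unitVec, truncate_apply]

theorem map_truncate (T : C₀(ℕ, 𝕜) →L[𝕜] X) (s : Finset ℕ) (b : ℕ → 𝕜) :
    T (truncate s b) = ∑ i ∈ s, b i • T (unitVec 𝕜 i) := by
  simp only [truncate_eq_sum, map_sum, _root_.map_smul]

theorem hasSum_smul_unitVec (a : C₀(ℕ, 𝕜)) : HasSum (fun i => a i • unitVec 𝕜 i) a := by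
  rw [HasSum, SummationFilter.unconditional_filter, Metric.tendsto_nhds]
  intro ε hε
  obtain ⟨N, hN⟩ := eventually_atTop.1
    ((tendsto_zero_iff_norm_tendsto_zero.1 (c0_tendsto_zero a)).eventually
      (gt_mem_nhds (half_pos hε)))
  filter_upwards [eventually_ge_atTop (Finset.range N)] with s hs
  rw [dist_eq_norm', ← truncate_eq_sum]
  refine ((c0_norm_le_iff (half_pos hε).le).2 fun j => ?_).trans_lt (half_lt_self hε)
  rw [ZeroAtInftyContinuousMap.sub_apply, truncate_apply]
  split_ifs with hj
  · simpa only [sub_self, norm_zero] using (half_pos hε).le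
  · rw [sub_zero]
    exact (hN j (not_lt.1 fun h => hj (hs (Finset.mem_range.2 h)))).le

theorem tsum_smul_map_unitVec (T : C₀(ℕ, 𝕜) →L[𝕜] X) (a : C₀(ℕ, 𝕜)) :
    ∑' i, a i • T (unitVec 𝕜 i) = T a := by
  simpa only [_root_.map_smul] using ((hasSum_smul_unitVec a).mapL T).tsum_eq

theorem isWUC_unitVec : IsWUC 𝕜 (unitVec 𝕜) := by
  intro φ
  choose θ hθ hθφ using fun i => RCLike.exists_norm_eq_mul_self (φ (unitVec 𝕜 i))
  refine summable_of_sum_le (c := ‖φ‖ * 1) (fun _ => norm_nonneg _) fun s => ?_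
  have hsum : φ (truncate s θ) = ((∑ i ∈ s, ‖φ (unitVec 𝕜 i)‖ : ℝ) : 𝕜) := by
    simp only [map_truncate, smul_eq_mul, ← hθφ, RCLike.ofReal_sum]
  calc ∑ i ∈ s, ‖φ (unitVec 𝕜 i)‖ = ‖φ (truncate s θ)‖ := by
        rw [hsum, RCLike.norm_of_nonneg (Finset.sum_nonneg fun _ _ => norm_nonneg _)]
    _ ≤ ‖φ‖ * 1 := φ.le_opNorm_of_le (norm_truncate_le s fun i => (hθ i).le)

end UnitVectors

section WUC

variable {𝕜 : Type*} [RCLike 𝕜] {X : Type*} [NormedAddCommGroup X] [NormedSpace 𝕜 X]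
  {x : ℕ → X}

namespace IsWUC

theorem map {Z : Type*} [NormedAddCommGroup Z] [NormedSpace 𝕜 Z] (hx : IsWUC 𝕜 x)
    (T : X →L[𝕜] Z) : IsWUC 𝕜 fun n => T (x n) :=
  fun φ => hx (φ.comp T)

theorem smul (hx : IsWUC 𝕜 x) {b : ℕ → 𝕜} {R : ℝ} (hb : ∀ i, ‖b i‖ ≤ R) :
    IsWUC 𝕜 fun i => b i • x i := by
  refine fun φ => ((hx φ).mul_left R).of_nonneg_of_le (fun _ => norm_nonneg _) fun i => ?_
  rw [_root_.map_smul, norm_smul]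
  gcongr
  exact hb i

theorem exists_norm_sum_smul_le (hx : IsWUC 𝕜 x) :
    ∃ C, ∀ (s : Finset ℕ) (a : C₀(ℕ, 𝕜)), ‖∑ i ∈ s, a i • x i‖ ≤ C * ‖a‖ := by
  let coord (i : ℕ) : C₀(ℕ, 𝕜) →L[𝕜] 𝕜 :=
    LinearMap.mkContinuous ⟨⟨fun a => a i, fun _ _ => rfl⟩, fun _ _ => rfl⟩ 1 fun a => by
      simpa using c0_norm_apply_le a i
  let S (s : Finset ℕ) : C₀(ℕ, 𝕜) →L[𝕜] X := ∑ i ∈ s, (coord i).smulRight (x i)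
  have hS (s : Finset ℕ) (a : C₀(ℕ, 𝕜)) : S s a = ∑ i ∈ s, a i • x i := by
    simp [S, coord]
  have hweak (a : C₀(ℕ, 𝕜)) (φ : StrongDual 𝕜 X) : ∃ B, ∀ s, ‖φ (S s a)‖ ≤ B := by
    refine ⟨‖a‖ * ∑' i, ‖φ (x i)‖, fun s => ?_⟩
    calc ‖φ (S s a)‖ = ‖∑ i ∈ s, a i • φ (x i)‖ := by simp only [hS, map_sum, _root_.map_smul]
      _ ≤ ∑ i ∈ s, ‖a‖ * ‖φ (x i)‖ := norm_sum_le_of_le s fun i _ => by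
        rw [norm_smul]
        gcongr
        exact c0_norm_apply_le a i
      _ ≤ ‖a‖ * ∑' i, ‖φ (x i)‖ := by
        rw [← Finset.mul_sum]
        gcongr
        exact (hx φ).sum_le_tsum s fun _ _ => norm_nonneg _
  have hstrong (a : C₀(ℕ, 𝕜)) : ∃ B, ∀ s, ‖S s a‖ ≤ B := by
    simpa only [LinearIsometry.norm_map] using banach_steinhaus
      (g := fun s => NormedSpace.inclusionInDoubleDualLi 𝕜 (S s a)) (hweak a)
  obtain ⟨C, hC⟩ := banach_steinhaus hstrong
  exact ⟨C, fun s a => hS s a ▸ (S s).le_of_opNorm_le (hC s) a⟩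

theorem summable_smul [CompleteSpace X] (hx : IsWUC 𝕜 x) (a : C₀(ℕ, 𝕜)) :
    Summable fun i => a i • x i := by
  obtain ⟨C, hC⟩ := hx.exists_norm_sum_smul_le
  rw [summable_iff_vanishing_norm]
  intro ε hε
  obtain ⟨s, hs⟩ := summable_iff_vanishing_norm.1 (hasSum_smul_unitVec a).summable
    (ε / (|C| + 1)) (by positivity)
  refine ⟨s, fun t ht => ?_⟩
  have hsmall := hs t ht
  rw [← truncate_eq_sum, lt_div_iff₀' (by positivity)] at hsmall
  calc ‖∑ i ∈ t, a i • x i‖ = ‖∑ i ∈ t, truncate t a i • x i‖ := congrArg norm <|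
        Finset.sum_congr rfl fun i hi => by rw [truncate_apply, if_pos hi]
    _ ≤ C * ‖truncate t a‖ := hC t _
    _ ≤ (|C| + 1) * ‖truncate t a‖ := by
        gcongr
        linarith [le_abs_self C]
    _ < ε := hsmall

theorem exists_clm [CompleteSpace X] (hx : IsWUC 𝕜 x) :
    ∃ T : C₀(ℕ, 𝕜) →L[𝕜] X, ∀ i, T (unitVec 𝕜 i) = x i := by
  obtain ⟨C, hC⟩ := hx.exists_norm_sum_smul_le
  let L : C₀(ℕ, 𝕜) →ₗ[𝕜] X :=
    { toFun a := ∑' i, a i • x i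
      map_add' a b := by
        simp only [ZeroAtInftyContinuousMap.add_apply, add_smul]
        exact (hx.summable_smul a).tsum_add (hx.summable_smul b)
      map_smul' c a := by
        simp only [ZeroAtInftyContinuousMap.smul_apply, smul_assoc]
        exact (hx.summable_smul a).tsum_const_smul c }
  refine ⟨L.mkContinuous C fun a =>
    le_of_tendsto' (hx.summable_smul a).hasSum.norm fun s => hC s a, fun i => ?_⟩
  change ∑' j, unitVec 𝕜 i j • x j = x i
  rw [tsum_eq_single i fun j hj => by simp [unitVec, truncate_apply, hj]]
  simp [unitVec, truncate_apply]

end IsWUC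

end WUC

section UnconditionalConvergence

theorem IsUC.exists_tendsto_sum_indicator {X : Type*} [NormedAddCommGroup X] {x : ℕ → X}
    (hx : IsUC x) (s : Set ℕ) :
    ∃ y, Tendsto (fun n => ∑ i ∈ Finset.range n, s.indicator x i) atTop (𝓝 y) := by
  classical
  rcases s.finite_or_infinite with hs | hs
  · exact ⟨_, (summable_of_hasFiniteSupport
      (hs.subset Set.support_indicator_subset)).hasSum.tendsto_sum_nat⟩
  obtain ⟨y, hy⟩ := hx (Nat.nth (· ∈ s)) (Nat.nth_strictMono hs)
  have hcount : Tendsto (Nat.count (· ∈ s)) atTop atTop :=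
    tendsto_atTop_atTop_of_monotone (Nat.count_monotone _) fun k =>
      ⟨Nat.nth (· ∈ s) k, (Nat.count_nth_of_infinite (p := (· ∈ s)) hs k).ge⟩
  refine ⟨y, (hy.comp hcount).congr fun n => ?_⟩
  induction n with
  | zero => simp
  | succ n ih =>
    rw [Finset.sum_range_succ, ← ih, Function.comp_apply, Function.comp_apply, Nat.count_succ]
    split_ifs with hn
    · rw [Finset.sum_range_succ, Nat.nth_count (p := (· ∈ s)) hn, Set.indicator_of_mem hn]
    · rw [Set.indicator_of_notMem hn, add_zero, add_zero]

theorem cauchySeq_of_forall_exists_norm_sub_le {E : Type*} [NormedAddCommGroup E] {u : ℕ → E}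
    (h : ∀ ε > 0, ∃ v : ℕ → E, CauchySeq v ∧ ∀ n, ‖u n - v n‖ ≤ ε) : CauchySeq u := by
  rw [Metric.cauchySeq_iff']
  intro ε hε
  obtain ⟨v, hv, huv⟩ := h (ε / 3) (by positivity)
  obtain ⟨N, hN⟩ := Metric.cauchySeq_iff'.1 hv (ε / 3) (by positivity)
  refine ⟨N, fun n hn => ?_⟩
  have hdist (m : ℕ) : dist (u m) (v m) ≤ ε / 3 := dist_eq_norm (u m) _ ▸ huv m
  linarith [dist_triangle4_right (u n) (u N) (v n) (v N), hdist n, hdist N, hN n hn]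

variable {𝕜 : Type*} [RCLike 𝕜] {X : Type*} [NormedAddCommGroup X] [NormedSpace 𝕜 X]

theorem IsUC.cauchySeq_sum_smul_of_finite_range {x : ℕ → X} (hx : IsUC x) {r : ℕ → 𝕜}
    (hr : (Set.range r).Finite) : CauchySeq fun n => ∑ i ∈ Finset.range n, r i • x i := by
  classical
  choose y hy using fun v : 𝕜 => hx.exists_tendsto_sum_indicator {i | r i = v}
  refine ((tendsto_finsetSum hr.toFinset fun v _ => (hy v).const_smul v).congr
    fun n => ?_).cauchySeq
  simp only [Finset.smul_sum]
  rw [Finset.sum_comm]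
  refine Finset.sum_congr rfl fun i _ => ?_
  simp [Set.indicator_apply]

theorem exists_finite_range_norm_sub_le {E : Type*} [NormedAddCommGroup E] [ProperSpace E]
    {ι : Type*} {b : ι → E} {R : ℝ} (hb : ∀ i, ‖b i‖ ≤ R) {ε : ℝ} (hε : 0 < ε) :
    ∃ r : ι → E, (Set.range r).Finite ∧ ∀ i, ‖b i - r i‖ ≤ ε := by
  obtain ⟨t, ht, hcov⟩ := Metric.totallyBounded_iff.1
    (isCompact_closedBall (0 : E) R).totallyBounded ε hε
  have hnear (i : ι) : ∃ v ∈ t, ‖b i - v‖ < ε := by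
    simpa only [Set.mem_iUnion₂, mem_ball_iff_norm, exists_prop] using
      hcov (mem_closedBall_zero_iff.2 (hb i))
  choose r hrt hr using hnear
  exact ⟨r, ht.subset (Set.range_subset_iff.2 hrt), fun i => (hr i).le⟩

theorem IsUC.cauchySeq_map_truncate {T : C₀(ℕ, 𝕜) →L[𝕜] X}
    (hT : IsUC fun i => T (unitVec 𝕜 i)) {b : ℕ → 𝕜} {R : ℝ} (hb : ∀ i, ‖b i‖ ≤ R) :
    CauchySeq fun n => T (truncate (Finset.range n) b) := by
  refine cauchySeq_of_forall_exists_norm_sub_le fun ε hε => ?_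
  obtain ⟨r, hr, hbr⟩ := exists_finite_range_norm_sub_le hb (ε := ε / (‖T‖ + 1)) (by positivity)
  refine ⟨_, hT.cauchySeq_sum_smul_of_finite_range hr, fun n => ?_⟩
  rw [map_truncate, ← Finset.sum_sub_distrib]
  simp only [← sub_smul]
  rw [← map_truncate T (Finset.range n) fun i => b i - r i]
  calc _ ≤ ‖T‖ * (ε / (‖T‖ + 1)) := T.le_opNorm_of_le (norm_truncate_le _ hbr)
    _ ≤ (‖T‖ + 1) * (ε / (‖T‖ + 1)) := by
      gcongr
      linarith
    _ = ε := mul_div_cancel₀ ε (by positivity)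

theorem isUC_map_unitVec_iff [CompleteSpace X] (T : C₀(ℕ, 𝕜) →L[𝕜] X) :
    IsUC (fun i => T (unitVec 𝕜 i)) ↔ CoordUniformContinuous T := by
  classical
  refine ⟨fun h => (isHomogeneousPolynomial_clm T).coordUniformContinuous_of_truncate
    fun R b hb => ?_, fun h σ hσ => ?_⟩
  · obtain ⟨y, hy⟩ := cauchySeq_tendsto_of_complete (h.cauchySeq_map_truncate hb)
    exact ⟨y, fun φ => (φ.continuous.tendsto y).comp hy⟩
  · have hcoord (j : ℕ) : Tendsto (fun n => truncate ((Finset.range n).image σ) (1 : ℕ → 𝕜) j)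
        atTop (𝓝 (if j ∈ Set.range σ then 1 else 0)) := by
      refine tendsto_const_nhds.congr' ?_
      by_cases hj : j ∈ Set.range σ
      · obtain ⟨i, rfl⟩ := hj
        filter_upwards [eventually_gt_atTop i] with n hn
        rw [truncate_apply, if_pos ⟨i, rfl⟩,
          if_pos (Finset.mem_image_of_mem σ (Finset.mem_range.2 hn)), Pi.one_apply]
      · filter_upwards with n
        have hjn : j ∉ (Finset.range n).image σ := fun h =>
          hj (Finset.coe_image_subset_range (Finset.mem_coe.2 h))
        rw [truncate_apply, if_neg hj, if_neg hjn]
    have hcauchy := h.cauchySeq (R := 1) (fun n => norm_truncate_le _ fun _ => norm_one.le) hcoord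
    simpa only [map_truncate, Finset.sum_image hσ.injective.injOn, Pi.one_apply, one_smul] using
      cauchySeq_tendsto_of_complete hcauchy

end UnconditionalConvergence

section Characterizations

variable {𝕜 : Type*} [RCLike 𝕜] {X : Type*} [NormedAddCommGroup X] [NormedSpace 𝕜 X]
  [CompleteSpace X] {Y : Type*} [NormedAddCommGroup Y] [NormedSpace 𝕜 Y] [CompleteSpace Y]
  {k : ℕ} {P : X → Y}

theorem forall_isWUCSet_iff {X : Type*} [NormedAddCommGroup X] [NormedSpace 𝕜 X]
    {p : Set X → Prop} :
    (∀ A, IsWUCSet 𝕜 A → p A) ↔ ∀ T : C₀(ℕ, 𝕜) →L[𝕜] X, p (T '' Metric.closedBall 0 1) :=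
  ⟨fun h T => h _ ⟨T, rfl⟩, fun h _ ⟨T, hA⟩ => hA ▸ h T⟩

theorem IsHomogeneousPolynomial.isUnconditionallyConverging_iff
    (hP : IsHomogeneousPolynomial 𝕜 k P) :
    IsUnconditionallyConverging 𝕜 P ↔
      ∀ T : C₀(ℕ, 𝕜) →L[𝕜] X, CoordUniformContinuous fun a => P (T a) := by
  refine ⟨fun h T => (hP.comp_clm T).coordUniformContinuous_of_truncate fun R b hb => ?_,
    fun h x hx => ?_⟩
  · obtain ⟨y, hy⟩ := h _ ((isWUC_unitVec.map T).smul hb)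
    simp only [← map_truncate] at hy
    exact ⟨y, fun φ => (φ.continuous.tendsto y).comp hy⟩
  · obtain ⟨T, hT⟩ := hx.exists_clm
    have := (h T).cauchySeq (R := 1) (fun n => norm_truncate_le _ fun _ => norm_one.le)
      (tendsto_truncate_range_apply fun _ => 1)
    simpa only [map_truncate, one_smul, hT] using cauchySeq_tendsto_of_complete this

theorem IsHomogeneousPolynomial.isOrliczPettis_iff (hP : IsHomogeneousPolynomial 𝕜 k P) :
    IsOrliczPettis 𝕜 P ↔ ∀ T : C₀(ℕ, 𝕜) →L[𝕜] X,
      (CoordUniformContinuous fun a => P (T a)) → CoordUniformContinuous T := by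
  refine ⟨fun h T hPT => (isUC_map_unitVec_iff T).1 (h _ (isWUC_unitVec.map T) fun a ha => ?_),
    fun h x hx hc => ?_⟩
  · obtain ⟨R, hR⟩ := ha.exists_norm_le
    refine (hPT.isRelCompact_image R).isRelWeaklyCompact.mono ?_
    rintro _ ⟨n, rfl⟩
    exact ⟨a n, mem_closedBall_zero_iff.2 (hR _ ⟨n, rfl⟩),
      congrArg P (tsum_smul_map_unitVec T (a n)).symm⟩
  · obtain ⟨T, hT⟩ := hx.exists_clm
    obtain rfl : (fun i => T (unitVec 𝕜 i)) = x := funext hT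
    simp only [tsum_smul_map_unitVec] at hc
    refine (isUC_map_unitVec_iff T).2 (h T ?_)
    refine (hP.comp_clm T).coordUniformContinuous_of_isRelWeaklyCompact_range fun a ha => hc a ?_
    exact isBounded_iff_forall_norm_le.2 ⟨1, Set.forall_mem_range.2 ha⟩

end Characterizations

end OrliczPettis

theorem proposition2p3 {𝕜 : Type*} [RCLike 𝕜]
    {X : Type*} [NormedAddCommGroup X] [NormedSpace 𝕜 X] [CompleteSpace X]
    {Y : Type*} [NormedAddCommGroup Y] [NormedSpace 𝕜 Y] [CompleteSpace Y]
    (k : ℕ) (hk : 1 ≤ k) (P : X → Y) (hP : OrliczPettis.IsHomogeneousPolynomial 𝕜 k P) :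
    ((OrliczPettis.IsUnconditionallyConverging 𝕜 P ↔
        ∀ A : Set X, OrliczPettis.IsWUCSet 𝕜 A → OrliczPettis.IsRelCompact (P '' A)) ∧
      (OrliczPettis.IsUnconditionallyConverging 𝕜 P ↔
        ∀ A : Set X, OrliczPettis.IsWUCSet 𝕜 A → OrliczPettis.IsRelWeaklyCompact 𝕜 (P '' A))) ∧
    ((OrliczPettis.IsOrliczPettis 𝕜 P ↔
        ∀ A : Set X, OrliczPettis.IsWUCSet 𝕜 A →
          OrliczPettis.IsRelCompact (P '' A) → OrliczPettis.IsRelCompact A) ∧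
      (OrliczPettis.IsOrliczPettis 𝕜 P ↔
        ∀ A : Set X, OrliczPettis.IsWUCSet 𝕜 A →
          OrliczPettis.IsRelWeaklyCompact 𝕜 (P '' A) → OrliczPettis.IsRelWeaklyCompact 𝕜 A)) := by
  have hcompact (T : C₀(ℕ, 𝕜) →L[𝕜] X) := (hP.comp_clm T).isRelCompact_image_iff
  have hweak (T : C₀(ℕ, 𝕜) →L[𝕜] X) := (hP.comp_clm T).isRelWeaklyCompact_image_iff
  have hTcompact (T : C₀(ℕ, 𝕜) →L[𝕜] X) :=
    (OrliczPettis.isHomogeneousPolynomial_clm T).isRelCompact_image_iff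
  have hTweak (T : C₀(ℕ, 𝕜) →L[𝕜] X) :=
    (OrliczPettis.isHomogeneousPolynomial_clm T).isRelWeaklyCompact_image_iff
  simp only [OrliczPettis.forall_isWUCSet_iff, Set.image_image, hcompact, hweak, hTcompact,
    hTweak, hP.isUnconditionallyConverging_iff, hP.isOrliczPettis_iff, and_self]
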